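/- Let $H_{3,d}$ be the real vector space of real homogeneous polynomials of degree $d$ in three variables (including $0$), let $P_{3,6}\subset H_{3,6}$ be the cone of sextics that are nonnegative on $\mathbb{R}^3$, let $\Sigma_{3,6}$ be the cone of finite sums of squares of elements of $H_{3,3}$, and let $\Sigma_{3,6}^*$ be the cone of linear functionals $l:H_{3,6}\to\mathbb{R}$ with $l(\Sigma_{3,6})\ge 0$. For a form $f$ let $\mathcal V(f)\subset\mathbb P^2(\mathbb R)$ be the set of its real projective zeros. **Theorem 3.1.** Let $p\in\partial P_{3,6}$ (topological boundary in $H_{3,6}$) with $p\notin\Sigma_{3,6}$. Let $v_1,\dots,v_9\in\mathbb{R}^3\setminus\{0\}$ represent nine distinct points $[v_1],\dots,[v_9]$ of $\mathbb P^2(\mathbb R)$, no four of them on a line and no seven of them on a conic, such that $\mathcal V(q_1)\cap\mathcal V(q_2)=\{[v_1],\dots,[v_9]\}$ for some coprime $q_1,q_2\in H_{3,3}$, and such that $\mathcal V(p)=\{[v_1],\dots,[v_k]\}$ for some $k$ with $1\le k\le 8$. Then there is, uniquely up to scaling, a nonzero vector $u=(u_1,\dots,u_9)\in\mathbb{R}^9$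 with $$\sum_{j=1}^9 u_j f(v_j)=0\quad\text{for all } f\in H_{3,3},$$ and all its entries $u_j$ are nonzero (the Cayley–Bacharach coefficients). If $$(u_{k+1}^2+\dots+u_8^2)\,(p(v_{k+1})+\dots+p(v_8))<u_9^2\,p(v_9)$$ (empty sums being $0$), then there is $a=(a_1,\dots,a_9)\in\mathbb{R}^9$ such that the functional $$l_a:H_{3,6}\to\mathbb{R},\qquad l_a(f)=\sum_{j=1}^9 a_j f(v_j),$$ satisfies $l_a(p)<0$ and $l_a(g)\ge 0$ for all $g\in\Sigma_{3,6}$, and $l_a$ spans an extreme ray of $\Sigma_{3,6}^*$. -/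

import Mathlib

open scoped LinearAlgebra.Projectivization

namespace SexticSOS

/-- `H_{n,d}`: the real vector space of homogeneous polynomials (forms) of degree `d`
in `n` variables, together with the zero form. -/
abbrev Form (n d : ℕ) : Type :=
  ↥(MvPolynomial.homogeneousSubmodule (Fin n) ℝ d)

/-- The usual topology of the finite-dimensional real vector space `H_{n,d}`: the module
topology, the one for which every linear isomorphism with some `ℝ^N` is a homeomorphism. -/
noncomputable instance formTopology (n d : ℕ) : TopologicalSpace (Form n d) :=
  moduleTopology ℝ (Form n d)

instance formIsModuleTopology (n d : ℕ) : IsModuleTopology ℝ (Form n d) := ⟨rfl⟩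

/-- Evaluation of forms at a vector `v`, as a linear functional `f ↦ f(v)`. -/
noncomputable def evalAt {n d : ℕ} (v : Fin n → ℝ) : Form n d →ₗ[ℝ] ℝ :=
  (MvPolynomial.aeval v).toLinearMap ∘ₗ (MvPolynomial.homogeneousSubmodule (Fin n) ℝ d).subtype

theorem evalAt_apply {n d : ℕ} (v : Fin n → ℝ) (f : Form n d) :
    evalAt v f = MvPolynomial.eval v (f : MvPolynomial (Fin n) ℝ) := by
  simp [evalAt]

theorem evalAt_smul {n d : ℕ} (c : ℝ) (v : Fin n → ℝ) (f : Form n d) :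
    evalAt (c • v) f = c ^ d * evalAt v f := by
  have hf : (f : MvPolynomial (Fin n) ℝ).IsHomogeneous d :=
    (MvPolynomial.mem_homogeneousSubmodule d _).1 f.2
  simp only [evalAt_apply, MvPolynomial.eval_eq, Pi.smul_apply, smul_eq_mul, Finset.mul_sum]
  refine Finset.sum_congr rfl fun m hm => ?_
  have hs : ∑ i ∈ m.support, m i = d := (hf.degree_eq_sum_deg_support hm).symm
  simp only [mul_pow, Finset.prod_mul_distrib, Finset.prod_pow_eq_pow_sum]
  rw [hs]
  ring

/-- `V(f)`: the set of real projective zeros of the form `f`. -/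
def projVariety {n d : ℕ} (f : Form n d) : Set (ℙ ℝ (Fin n → ℝ)) :=
  {x | evalAt x.rep f = 0}

/-- Whether a projective point is a zero of `f` can be tested at any representative. -/
theorem mk_mem_projVariety {n d : ℕ} (f : Form n d) (v : Fin n → ℝ) (hv : v ≠ 0) :
    Projectivization.mk ℝ v hv ∈ projVariety f ↔ evalAt v f = 0 := by
  obtain ⟨a, ha⟩ := Projectivization.exists_smul_eq_mk_rep ℝ v hv
  have ha' : (Projectivization.mk ℝ v hv).rep = (a : ℝ) • v := ha.symm
  simp [projVariety, ha', evalAt_smul]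

/-- `P_{n,d}`: the cone of nonnegative forms. -/
def nonnegForms (n d : ℕ) : Set (Form n d) :=
  {f | ∀ x : Fin n → ℝ, 0 ≤ evalAt x f}

/-- `Σ_{n,2d}`: the cone of sums of squares of forms of degree `d`. -/
def sosForms (n d : ℕ) : Set (Form n (2 * d)) :=
  {f | ∃ (m : ℕ) (g : Fin m → Form n d),
    (f : MvPolynomial (Fin n) ℝ) = ∑ i, (g i : MvPolynomial (Fin n) ℝ) ^ 2}

/-- `Σ_{n,2d}^*`: the cone of linear functionals on `H_{n,2d}` which are nonnegative on
`Σ_{n,2d}`. -/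
noncomputable def sosDual (n d : ℕ) : PointedCone ℝ (Module.Dual ℝ (Form n (2 * d))) :=
  PointedCone.dual (Module.Dual.eval ℝ (Form n (2 * d))) (sosForms n d)

/-- The vector `x` spans an extreme ray of the cone `K`: it is nonzero, and the ray of its
nonnegative multiples is a face of `K` (in particular it lies in `K`). -/
def SpansExtremeRay {M : Type*} [AddCommGroup M] [Module ℝ M] (K : PointedCone ℝ M) (x : M) :
    Prop :=
  x ≠ 0 ∧ (PointedCone.hull ℝ {x}).IsFaceOf K

/-- No four of the points lie on a line, and no seven lie on a quadric (conic). -/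
def Generic {N : ℕ} (v : Fin N → Fin 3 → ℝ) : Prop :=
  (∀ f : Form 3 1, f ≠ 0 → {j | evalAt (v j) f = 0}.ncard ≤ 3) ∧
  (∀ f : Form 3 2, f ≠ 0 → {j | evalAt (v j) f = 0}.ncard ≤ 6)

/-- `u` is a nontrivial linear relation between the values of all ternary cubics
at the points `v j`. -/
def IsCayleyBacharach (v : Fin 9 → Fin 3 → ℝ) (u : Fin 9 → ℝ) : Prop :=
  u ≠ 0 ∧ ∀ f : Form 3 3, ∑ j, u j * evalAt (v j) f = 0

/-- The point evaluation functional `l_a : f ↦ ∑ j, a j * f (v j)` on ternary sextics. -/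
noncomputable def pointFunctional (v : Fin 9 → Fin 3 → ℝ) (a : Fin 9 → ℝ) :
    Module.Dual ℝ (Form 3 (2 * 3)) :=
  ∑ j, a j • evalAt (v j)

end SexticSOS

namespace SexticSOS

/-! A relation among values of cubics, multiplied pointwise by the values of a form, is a relation
in lower degree. With general position this makes any cubic relation with a zero entry vanish
(`relation_cubic_eq_zero`), so the relation `u` is unique up to scaling and has no zero entry. It
exists because `q₁`, `q₂` lie in the kernel of evaluation, whose rank is then at most 8.

Values of cubics thus fill the hyperplane `u`^⊥, and `l_a(f²) = ∑ a_j x_j²` there. Take `a 8 = -1`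
and the other weights positive with `∑ u_j² / a_j = 0`: Cauchy–Schwarz gives nonnegativity
(`weighted_sum_nonneg`). Weights at zeros of `p` do not affect `l_a(p)`, so they can be large; the
inequality leaves room for a common weight at the remaining points making `l_a(p) < 0`
(`exists_weights`).

The equality `∑ u_j² / a_j = 0` produces a third cubic `q₃`, with values `u_j / a_j`, in the kernel
of `l_a`. A summand of `l_a` in the dual cone kills all multiples of `q₁`, `q₂`, `q₃`. The first two
force it to be a point functional by a dimension count (`exists_eq_pointFunctional`), and `q₃`
forces its weights to be proportional to `a`. -/

theorem finrank_form (n d : ℕ) :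
    Module.finrank ℝ (Form n d) = (n + d - 1).choose d := by
  have h1 : {m : Fin n →₀ ℕ | m.degree = d} =
      ((Finset.univ : Finset (Fin n)).finsuppAntidiag d : Set _) := by
    ext m
    simp [Finset.mem_finsuppAntidiag, Finsupp.degree_eq_sum]
  have h2 : MvPolynomial.homogeneousSubmodule (Fin n) ℝ d = Submodule.span ℝ
      (Set.range fun m : (Finset.univ : Finset (Fin n)).finsuppAntidiag d =>
        MvPolynomial.monomial (m : Fin n →₀ ℕ) (1 : ℝ)) := by
    rw [MvPolynomial.homogeneousSubmodule_eq_finsupp_supported,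
      AddMonoidAlgebra.supported_eq_span_single, h1]
    congr 1
    ext x
    simp [MvPolynomial.single_eq_monomial]
  have h3 : LinearIndependent ℝ fun m : (Finset.univ : Finset (Fin n)).finsuppAntidiag d =>
      MvPolynomial.monomial (m : Fin n →₀ ℕ) (1 : ℝ) := by
    have := (MvPolynomial.basisMonomials (Fin n) ℝ).linearIndependent
    rw [MvPolynomial.coe_basisMonomials] at this
    exact this.comp _ Subtype.val_injective
  change Module.finrank ℝ ↥(MvPolynomial.homogeneousSubmodule (Fin n) ℝ d) = _
  rw [h2, finrank_span_eq_card h3, Fintype.card_coe, Finset.card_finsuppAntidiag_nat_eq_choose]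
  simp

instance form_finite (n d : ℕ) : Module.Finite ℝ (Form n d) :=
  Module.Finite.iff_fg.2 (MvPolynomial.homogeneousSubmodule_fg (Fin n) ℝ d)

/-- Multiplication of forms, as a bilinear map. -/
noncomputable def mulForm {n a b c : ℕ} (h : a + b = c) :
    Form n a →ₗ[ℝ] Form n b →ₗ[ℝ] Form n c :=
  LinearMap.mk₂ ℝ
    (fun f g => ⟨(f : MvPolynomial (Fin n) ℝ) * g, by
      have := MvPolynomial.IsHomogeneous.mul
        ((MvPolynomial.mem_homogeneousSubmodule _ _).1 f.2)
        ((MvPolynomial.mem_homogeneousSubmodule _ _).1 g.2)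
      rw [h] at this
      exact this⟩)
    (fun _ _ _ => Subtype.ext (add_mul _ _ _))
    (fun _ _ _ => Subtype.ext (smul_mul_assoc _ _ _))
    (fun _ _ _ => Subtype.ext (mul_add _ _ _))
    (fun _ _ _ => Subtype.ext (mul_smul_comm _ _ _))

theorem coe_mulForm {n a b c : ℕ} (h : a + b = c) (f : Form n a) (g : Form n b) :
    (mulForm h f g : MvPolynomial (Fin n) ℝ) = f * g := rfl

theorem evalAt_mulForm {n a b c : ℕ} (h : a + b = c) (f : Form n a) (g : Form n b)
    (x : Fin n → ℝ) : evalAt x (mulForm h f g) = evalAt x f * evalAt x g := by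
  simp [evalAt_apply, coe_mulForm]

/-- The linear form with coefficient vector `w`. -/
noncomputable def linForm {n : ℕ} (w : Fin n → ℝ) : Form n 1 :=
  ⟨∑ i, MvPolynomial.C (w i) * MvPolynomial.X i, by
    rw [MvPolynomial.mem_homogeneousSubmodule]
    exact MvPolynomial.IsHomogeneous.sum _ _ _ fun i _ =>
      (MvPolynomial.isHomogeneous_C_mul_X (w i) i)⟩

theorem evalAt_linForm {n : ℕ} (w x : Fin n → ℝ) : evalAt x (linForm w) = ∑ i, w i * x i := by
  simp [evalAt_apply, linForm]

theorem linForm_ne_zero {n : ℕ} {w : Fin n → ℝ} (hw : w ≠ 0) : linForm w ≠ 0 := by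
  intro h
  apply hw
  ext i
  have := evalAt_linForm w (Pi.single i 1)
  rw [h] at this
  simpa [Pi.single_apply] using this.symm

open Matrix in
/-- The linear form vanishing at `a` and `b`. -/
noncomputable def lineForm (a b : Fin 3 → ℝ) : Form 3 1 := linForm (a ⨯₃ b)

theorem evalAt_lineForm (a b x : Fin 3 → ℝ) : evalAt x (lineForm a b) =
    (a 1 * b 2 - a 2 * b 1) * x 0 + (a 2 * b 0 - a 0 * b 2) * x 1 +
      (a 0 * b 1 - a 1 * b 0) * x 2 := by
  simp [lineForm, evalAt_linForm, Fin.sum_univ_three, cross_apply]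

theorem lineForm_ne_zero {a b : Fin 3 → ℝ} (ha : a ≠ 0) (hb : b ≠ 0)
    (h : Projectivization.mk ℝ a ha ≠ Projectivization.mk ℝ b hb) : lineForm a b ≠ 0 := by
  apply linForm_ne_zero
  rw [crossProduct_ne_zero_iff_linearIndependent, LinearIndependent.pair_iff' ha]
  intro c hc
  apply h
  symm
  rw [Projectivization.mk_eq_mk_iff']
  exact ⟨c, hc⟩

/-! ### General position, and five points on conics -/

section

/-- No two points coincide and no four of them are collinear, in terms of determinants. -/
def NoFourCollinear {N : ℕ} (v : Fin N → Fin 3 → ℝ) : Prop :=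
  ∀ i j k l : Fin N, [i, j, k, l].Nodup → evalAt (v k) (lineForm (v i) (v j)) = 0 →
    evalAt (v l) (lineForm (v i) (v j)) = 0 → False

theorem Generic.noFourCollinear {N : ℕ} {v : Fin N → Fin 3 → ℝ} (hv : ∀ j, v j ≠ 0)
    (hdist : Function.Injective fun j => Projectivization.mk ℝ (v j) (hv j))
    (hgen : Generic v) : NoFourCollinear v := by
  intro i j k l hnd hk hl
  have hij : i ≠ j := by simp at hnd; tauto
  have h := hgen.1 _ (lineForm_ne_zero (hv i) (hv j) fun h => hij (hdist h))
  have hsub : ((({i, j, k, l} : Finset (Fin N)) : Set (Fin N))) ⊆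
      {m | evalAt (v m) (lineForm (v i) (v j)) = 0} := by
    intro m hm
    simp only [Finset.coe_insert, Finset.coe_singleton, Set.mem_insert_iff,
      Set.mem_singleton_iff] at hm
    rcases hm with rfl | rfl | rfl | rfl
    · rw [Set.mem_ofPred_eq, evalAt_lineForm]; ring
    · rw [Set.mem_ofPred_eq, evalAt_lineForm]; ring
    · exact hk
    · exact hl
  have h4 := Set.ncard_le_ncard hsub (Set.toFinite _)
  rw [Set.ncard_coe_finset] at h4
  have : ({i, j, k, l} : Finset (Fin N)).card = 4 := by
    have := List.toFinset_card_of_nodup hnd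
    simpa using this
  omega

theorem evalAt_lineForm_left (a b : Fin 3 → ℝ) : evalAt a (lineForm a b) = 0 := by
  rw [evalAt_lineForm]; ring

theorem evalAt_lineForm_right (a b : Fin 3 → ℝ) : evalAt b (lineForm a b) = 0 := by
  rw [evalAt_lineForm]; ring

theorem evalAt_lineForm_rotate (a b c : Fin 3 → ℝ) :
    evalAt c (lineForm a b) = evalAt a (lineForm b c) := by
  rw [evalAt_lineForm, evalAt_lineForm]; ring

theorem evalAt_lineForm_swap (a b c : Fin 3 → ℝ) :
    evalAt c (lineForm a b) = -evalAt c (lineForm b a) := by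
  rw [evalAt_lineForm, evalAt_lineForm]; ring

variable {N : ℕ} {v : Fin N → Fin 3 → ℝ}

/-- Of two lines joining `i` to two further points, one misses a given fourth point. -/
theorem NoFourCollinear.line_ne_zero_or (h : NoFourCollinear v) {x i j k : Fin N}
    (hnd : [x, i, j, k].Nodup) : evalAt (v x) (lineForm (v i) (v j)) ≠ 0 ∨
      evalAt (v x) (lineForm (v i) (v k)) ≠ 0 := by
  by_contra! hc
  exact h x i j k hnd ((evalAt_lineForm_rotate _ _ _).trans hc.1)
    ((evalAt_lineForm_rotate _ _ _).trans hc.2)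

/-- A product of two lines pairing off `a, b, c, d` works. If `x` lies on one line of the pairing
`ab|cd`, it lies on neither line of `ac|bd`, since otherwise four points would be collinear. -/
theorem NoFourCollinear.exists_conic (h : NoFourCollinear v) {x a b c d : Fin N}
    (hnd : [x, a, b, c, d].Nodup) : ∃ f : Form 3 2, evalAt (v x) f ≠ 0 ∧
      evalAt (v a) f = 0 ∧ evalAt (v b) f = 0 ∧ evalAt (v c) f = 0 ∧ evalAt (v d) f = 0 := by
  have key : ∀ a b c d : Fin N, evalAt (v x) (lineForm (v a) (v b)) ≠ 0 →
      evalAt (v x) (lineForm (v c) (v d)) ≠ 0 → ∃ f : Form 3 2, evalAt (v x) f ≠ 0 ∧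
      evalAt (v a) f = 0 ∧ evalAt (v b) f = 0 ∧ evalAt (v c) f = 0 ∧ evalAt (v d) f = 0 := by
    intro a b c d h1 h2
    refine ⟨mulForm (by norm_num) (lineForm (v a) (v b)) (lineForm (v c) (v d)), ?_⟩
    simp [evalAt_mulForm, evalAt_lineForm_left, evalAt_lineForm_right, h1, h2]
  have swap : ∀ a b : Fin N, evalAt (v x) (lineForm (v a) (v b)) ≠ 0 →
      evalAt (v x) (lineForm (v b) (v a)) ≠ 0 := by
    intro a b h
    rwa [evalAt_lineForm_swap, neg_ne_zero]
  have good : ∀ i j k : Fin N, [x, i, j, k].Nodup → evalAt (v x) (lineForm (v i) (v j)) = 0 →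
      evalAt (v x) (lineForm (v i) (v k)) ≠ 0 := fun i j k hn h0 =>
    (h.line_ne_zero_or hn).resolve_left (not_not.2 h0)
  have swap0 : ∀ a b : Fin N, evalAt (v x) (lineForm (v a) (v b)) = 0 →
      evalAt (v x) (lineForm (v b) (v a)) = 0 := by
    intro a b h
    rwa [evalAt_lineForm_swap, neg_eq_zero]
  have nd : ∀ i j k, i ∈ [a, b, c, d] → j ∈ [a, b, c, d] → k ∈ [a, b, c, d] → i ≠ j → i ≠ k →
      j ≠ k → [x, i, j, k].Nodup := by
    intro i j k hi hj hk
    rw [List.nodup_cons] at hnd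
    have hx : ∀ i ∈ [a, b, c, d], x ≠ i := fun i hi h => hnd.1 (h ▸ hi)
    have := hx i hi
    have := hx j hj
    have := hx k hk
    simp_all
  simp only [List.nodup_cons, List.mem_cons, List.not_mem_nil, not_or, or_false,
    not_false_eq_true, List.nodup_nil, and_true] at hnd
  obtain ⟨-, ⟨hab, hac, had⟩, ⟨hbc, hbd⟩, hcd⟩ := hnd
  by_cases h1 : evalAt (v x) (lineForm (v a) (v b)) = 0
  · obtain ⟨f, hf⟩ := key a c b d (good a b c (nd _ _ _ (by simp) (by simp) (by simp)
      hab hac hbc) h1) (good b a d (nd _ _ _ (by simp) (by simp) (by simp)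
      (Ne.symm hab) hbd had) (swap0 _ _ h1))
    exact ⟨f, by tauto⟩
  by_cases h2 : evalAt (v x) (lineForm (v c) (v d)) = 0
  · obtain ⟨f, hf⟩ := key a c b d (swap _ _ (good c d a (nd _ _ _ (by simp) (by simp) (by simp)
      hcd (Ne.symm hac) (Ne.symm had)) h2)) (swap _ _ (good d c b (nd _ _ _ (by simp) (by simp)
      (by simp) (Ne.symm hcd) (Ne.symm hbd) (Ne.symm hbc)) (swap0 _ _ h2)))
    exact ⟨f, by tauto⟩
  exact key a b c d h1 h2

/-- A family of coefficients is a relation between the values of forms of degree `d`. -/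
def IsRelation (v : Fin N → Fin 3 → ℝ) (d : ℕ) (w : Fin N → ℝ) : Prop :=
  ∀ f : Form 3 d, ∑ j, w j * evalAt (v j) f = 0

theorem IsRelation.mul {d e m : ℕ} (hd : d + e = m) {w : Fin N → ℝ} (hw : IsRelation v m w)
    (g : Form 3 d) : IsRelation v e fun j => w j * evalAt (v j) g := by
  intro f
  have := hw (mulForm hd g f)
  simp only [evalAt_mulForm] at this
  simpa [mul_assoc] using this

/-- Five points, no four of them collinear, impose independent conditions on conics. -/
theorem NoFourCollinear.relation_conic_eq_zero (h : NoFourCollinear v) {x a b c d : Fin N}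
    (hnd : [x, a, b, c, d].Nodup) {w : Fin N → ℝ} (hw : IsRelation v 2 w)
    (hsupp : ∀ j, j ∉ [x, a, b, c, d] → w j = 0) : w x = 0 := by
  obtain ⟨f, hx, ha, hb, hc, hd⟩ := h.exists_conic hnd
  have := hw f
  rw [Finset.sum_eq_single x] at this
  · exact (mul_eq_zero.1 this).resolve_right hx
  · intro j _ hj
    by_cases hm : j ∈ [x, a, b, c, d]
    · simp only [List.mem_cons, List.not_mem_nil, or_false] at hm
      rcases hm with rfl | rfl | rfl | rfl | rfl <;> simp_all
    · simp [hsupp j hm]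
  · simp

end

/-! ### Eight points and cubics -/

section

theorem IsRelation.comp {N d : ℕ} {v : Fin N → Fin 3 → ℝ} {w : Fin N → ℝ}
    (hw : IsRelation v d w) (σ : Equiv.Perm (Fin N)) : IsRelation (v ∘ σ) d (w ∘ σ) := by
  intro f
  rw [← hw f]
  exact Equiv.sum_comp σ fun j => w j * evalAt (v j) f

theorem NoFourCollinear.comp {N : ℕ} {v : Fin N → Fin 3 → ℝ} (h : NoFourCollinear v)
    (σ : Equiv.Perm (Fin N)) : NoFourCollinear (v ∘ σ) := fun i j k l hnd =>
  h (σ i) (σ j) (σ k) (σ l) (hnd.map σ.injective)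

/-- No seven of the points lie on a conic. -/
def NoSevenConconic {N : ℕ} (v : Fin N → Fin 3 → ℝ) : Prop :=
  ∀ f : Form 3 2, ∀ g : Fin 7 → Fin N, Function.Injective g →
    (∀ i, evalAt (v (g i)) f = 0) → f = 0

theorem NoSevenConconic.comp {N : ℕ} {v : Fin N → Fin 3 → ℝ} (h : NoSevenConconic v)
    (σ : Equiv.Perm (Fin N)) : NoSevenConconic (v ∘ σ) := fun f g hg h0 =>
  h f (σ ∘ g) (σ.injective.comp hg) h0

theorem Generic.noSevenConconic {N : ℕ} {v : Fin N → Fin 3 → ℝ} (hgen : Generic v) :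
    NoSevenConconic v := by
  intro f g hg h0
  by_contra hf
  have h1 := hgen.2 f hf
  have h2 : (Set.range g).ncard ≤ {j | evalAt (v j) f = 0}.ncard :=
    Set.ncard_le_ncard (Set.range_subset_iff.2 h0) (Set.toFinite _)
  rw [← Set.image_univ, Set.ncard_image_of_injective _ hg, Set.ncard_univ] at h2
  simp at h2
  omega

variable {v : Fin 9 → Fin 3 → ℝ} {w : Fin 9 → ℝ}

theorem exists_perm_three (i j x : Fin 9) (hij : i ≠ j) (hix : i ≠ x) (hjx : j ≠ x) :
    ∃ σ : Equiv.Perm (Fin 9), σ 0 = i ∧ σ 1 = j ∧ σ 2 = x := by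
  have := Equiv.Perm.isMultiplyPretransitive (Fin 9) 3
  obtain ⟨σ, hσ⟩ := MulAction.exists_smul_eq (Equiv.Perm (Fin 9))
    (⟨![0, 1, 2], by decide⟩ : Fin 3 ↪ Fin 9) ⟨![i, j, x], by
      intro a b; fin_cases a <;> fin_cases b <;> simp [*, Ne.symm]⟩
  exact ⟨σ, DFunLike.congr_fun hσ 0, DFunLike.congr_fun hσ 1, DFunLike.congr_fun hσ 2⟩

/-- A line through two of the other points that misses point 2 kills two more entries, which leaves
a conic relation on five points. -/
theorem relation_cubic_apply_two (h : NoFourCollinear v) (hw : IsRelation v 3 w)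
    (h0 : w 0 = 0) (h1 : w 1 = 0) : w 2 = 0 := by
  rcases h.line_ne_zero_or (x := 2) (i := 3) (j := 4) (k := 5) (by decide) with hD | hD
  · have := h.relation_conic_eq_zero (x := 2) (a := 5) (b := 6) (c := 7) (d := 8) (by decide)
      (hw.mul (by norm_num) (lineForm (v 3) (v 4))) (by
        intro j hj
        fin_cases j <;>
          simp_all [evalAt_lineForm_left, evalAt_lineForm_right])
    exact (mul_eq_zero.1 this).resolve_right hD
  · have := h.relation_conic_eq_zero (x := 2) (a := 4) (b := 6) (c := 7) (d := 8) (by decide)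
      (hw.mul (by norm_num) (lineForm (v 3) (v 5))) (by
        intro j hj
        fin_cases j <;>
          simp_all [evalAt_lineForm_left, evalAt_lineForm_right])
    exact (mul_eq_zero.1 this).resolve_right hD

/-- Seven points, no four of them collinear, impose independent conditions on cubics. -/
theorem NoFourCollinear.relation_cubic_eq_zero (h : NoFourCollinear v) (hw : IsRelation v 3 w)
    {i j : Fin 9} (hij : i ≠ j) (hi : w i = 0) (hj : w j = 0) : w = 0 := by
  ext x
  by_cases hix : i = x
  · exact hix ▸ hi
  by_cases hjx : j = x
  · exact hjx ▸ hj
  obtain ⟨σ, rfl, rfl, rfl⟩ := exists_perm_three i j x hij hix hjx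
  exact relation_cubic_apply_two (h.comp σ) (hw.comp σ) hi hj

theorem exists_conic_through_five {N : ℕ} (v : Fin N → Fin 3 → ℝ) (g : Fin 5 → Fin N) :
    ∃ f : Form 3 2, f ≠ 0 ∧ ∀ i, evalAt (v (g i)) f = 0 := by
  have h : LinearMap.ker (LinearMap.pi fun i => evalAt (n := 3) (d := 2) (v (g i))) ≠ ⊥ := by
    apply LinearMap.ker_ne_bot_of_finrank_lt
    rw [finrank_form]
    simp [Nat.choose]
  obtain ⟨f, hf, hf0⟩ := Submodule.exists_mem_ne_zero_of_ne_bot h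
  exact ⟨f, hf0, fun i => congrFun (LinearMap.mem_ker.1 hf) i⟩

/-- Take a conic `Q` through points 1 to 5. Multiplying the relation by `Q` and the line through two
of the points 6, 7, 8 isolates the third, so `Q` vanishes there. Doing this for 6 and 7 puts seven
points on `Q`. -/
theorem relation_cubic_contradiction (h7 : NoSevenConconic v) (hw : IsRelation v 3 w)
    (h0 : w 0 = 0) (hne : ∀ j ≠ 0, w j ≠ 0) (hD : evalAt (v 6) (lineForm (v 7) (v 8)) ≠ 0) :
    False := by
  obtain ⟨Q, hQ, hz⟩ := exists_conic_through_five v ![1, 2, 3, 4, 5]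
  simp only [Fin.forall_fin_succ, Fin.forall_fin_zero] at hz
  simp at hz
  obtain ⟨z1, z2, z3, z4, z5⟩ := hz
  have e6 := hw.mul (d := 1) (by norm_num) (lineForm (v 7) (v 8)) Q
  have e7 := hw.mul (d := 1) (by norm_num) (lineForm (v 8) (v 6)) Q
  rw [evalAt_lineForm_rotate] at hD
  have hD' : evalAt (v 6) (lineForm (v 7) (v 8)) ≠ 0 := by
    rwa [evalAt_lineForm_rotate]
  simp [Fin.sum_univ_succ, z1, z2, z3, z4, z5, h0, evalAt_lineForm_left,
    evalAt_lineForm_right, hD, hD', hne] at e6 e7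
  refine hQ (h7 Q ![1, 2, 3, 4, 5, 6, 7] (by decide) ?_)
  simp only [Fin.forall_fin_succ]
  simp [z1, z2, z3, z4, z5, e6, e7]

/-- Eight points, no four of them collinear and no seven on a conic, impose independent
conditions on cubics. -/
theorem relation_cubic_eq_zero (h : NoFourCollinear v) (h7 : NoSevenConconic v)
    (hw : IsRelation v 3 w) {i : Fin 9} (hi : w i = 0) : w = 0 := by
  by_contra hw0
  have hne : ∀ j ≠ i, w j ≠ 0 := fun j hj h0 => hw0 (h.relation_cubic_eq_zero hw hj h0 hi)
  by_cases hD : evalAt (v (Equiv.swap 0 i 6))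
      (lineForm (v (Equiv.swap 0 i 7)) (v (Equiv.swap 0 i 8))) = 0
  -- If 6, 7, 8 are collinear, then 5, 7, 8 are not, so exchange 5 and 6.
  · refine relation_cubic_contradiction ((h7.comp (Equiv.swap 0 i)).comp (Equiv.swap 5 6))
      ((hw.comp (Equiv.swap 0 i)).comp (Equiv.swap 5 6)) ?_ ?_ ?_
    · have : Equiv.swap (5 : Fin 9) 6 0 = 0 := by decide
      simpa [this] using hi
    · intro j hj
      apply hne
      intro h0
      exact hj ((by decide : ∀ j, Equiv.swap (5 : Fin 9) 6 j = 0 → j = 0) j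
        ((Equiv.swap 0 i).injective (by simpa using h0)))
    · intro hD'
      have h7 : Equiv.swap (5 : Fin 9) 6 7 = 7 := by decide
      have h8 : Equiv.swap (5 : Fin 9) 6 8 = 8 := by decide
      simp only [Function.comp_apply, Equiv.swap_apply_right, h7, h8] at hD'
      exact (h.comp (Equiv.swap 0 i)) 7 8 6 5 (by decide) hD hD'
  · refine relation_cubic_contradiction (h7.comp (Equiv.swap 0 i)) (hw.comp (Equiv.swap 0 i))
      (by simpa using hi) ?_ hD
    intro j hj
    apply hne
    intro h0
    exact hj ((Equiv.swap 0 i).injective (by simpa using h0))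

end

/-- Values at the points annihilated by all relations are attained by a form. -/
theorem exists_form_of_forall_relation {N d : ℕ} {v : Fin N → Fin 3 → ℝ} (x : Fin N → ℝ)
    (hx : ∀ w, IsRelation v d w → ∑ j, w j * x j = 0) :
    ∃ f : Form 3 d, ∀ j, evalAt (v j) f = x j := by
  by_contra hc
  let E : Form 3 d →ₗ[ℝ] (Fin N → ℝ) := LinearMap.pi fun j => evalAt (v j)
  have hmem : x ∉ LinearMap.range E := by
    rintro ⟨f, hf⟩
    exact hc ⟨f, fun j => congrFun hf j⟩
  -- The coordinates of a functional separating `x` from the attained values form a relation.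
  obtain ⟨φ, hφx, hφ⟩ := Submodule.exists_dual_map_eq_bot_of_notMem hmem inferInstance
  have hsum : ∀ y : Fin N → ℝ, φ y = ∑ j, φ (fun i => if j = i then 1 else 0) * y j := by
    intro y
    rw [LinearMap.pi_apply_eq_sum_univ φ y]
    simp [mul_comm]
  apply hφx
  rw [hsum]
  apply hx
  intro f
  have h0 : φ (E f) ∈ (LinearMap.range E).map φ := ⟨E f, ⟨f, rfl⟩, rfl⟩
  rw [hφ, Submodule.mem_bot, hsum] at h0
  exact h0

/-! ### Coprime cubics and functionals on sextics -/

theorem not_isUnit_form {n d : ℕ} (hd : 0 < d) (q : Form n d) :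
    ¬ IsUnit (q : MvPolynomial (Fin n) ℝ) := by
  intro h
  have h0 := h.map (MvPolynomial.eval (0 : Fin n → ℝ))
  have h1 := evalAt_smul 0 (0 : Fin n → ℝ) q
  rw [zero_smul, zero_pow hd.ne', zero_mul, evalAt_apply] at h1
  rw [h1] at h0
  exact not_isUnit_zero h0

theorem form_ne_zero_of_isRelPrime {n d : ℕ} (hd : 0 < d) {q₁ q₂ : Form n d}
    (hq : IsRelPrime (q₁ : MvPolynomial (Fin n) ℝ) q₂) :
    (q₂ : MvPolynomial (Fin n) ℝ) ≠ 0 := by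
  intro h
  rw [h] at hq
  exact not_isUnit_form hd q₁ (hq dvd_rfl (dvd_zero _))

/-- The syzygies of equal degree between two coprime forms of the same degree are the
multiples of the Koszul syzygy. -/
theorem syzygy_of_isRelPrime {n d : ℕ} (hd : 0 < d) {q₁ q₂ : Form n d}
    (hq : IsRelPrime (q₁ : MvPolynomial (Fin n) ℝ) q₂) {f g : Form n d}
    (h : (q₁ : MvPolynomial (Fin n) ℝ) * f + q₂ * g = 0) :
    ∃ c : ℝ, f = c • q₂ ∧ g = -c • q₁ := by
  have hq2 := form_ne_zero_of_isRelPrime hd hq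
  have hdvd : (q₂ : MvPolynomial (Fin n) ℝ) ∣ q₁ * f := ⟨-g, by linear_combination h⟩
  obtain ⟨r, hr⟩ := hq.symm.dvd_of_dvd_mul_left hdvd
  -- Equal degrees make the quotient constant; `f = 0` is separate because its total degree need not
  -- be `d`.
  have hc : ∃ c : ℝ, r = MvPolynomial.C c := by
    by_cases hf : (f : MvPolynomial (Fin n) ℝ) = 0
    · refine ⟨0, ?_⟩
      rw [hf] at hr
      simpa using (mul_eq_zero.1 hr.symm).resolve_left hq2
    · have hr0 : r ≠ 0 := by
        rintro rfl
        exact hf (by simpa using hr)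
      have hdeg := MvPolynomial.totalDegree_mul_of_isDomain hq2 hr0
      have df : (f : MvPolynomial (Fin n) ℝ).totalDegree = d :=
        MvPolynomial.IsHomogeneous.totalDegree
          ((MvPolynomial.mem_homogeneousSubmodule _ _).1 f.2) hf
      have dq : (q₂ : MvPolynomial (Fin n) ℝ).totalDegree = d :=
        MvPolynomial.IsHomogeneous.totalDegree
          ((MvPolynomial.mem_homogeneousSubmodule _ _).1 q₂.2) hq2
      rw [← hr, df, dq] at hdeg
      exact ⟨_, MvPolynomial.totalDegree_eq_zero_iff_eq_C.1 (by omega)⟩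
  obtain ⟨c, rfl⟩ := hc
  refine ⟨c, Subtype.ext ?_, Subtype.ext ?_⟩
  · simp [hr, MvPolynomial.smul_eq_C_mul, mul_comm]
  · apply mul_left_cancel₀ hq2
    rw [hr] at h
    simp only [SetLike.val_smul, MvPolynomial.smul_eq_C_mul, map_neg]
    linear_combination h

theorem linearIndependent_of_isRelPrime {n d : ℕ} (hd : 0 < d) {q₁ q₂ : Form n d}
    (hq : IsRelPrime (q₁ : MvPolynomial (Fin n) ℝ) q₂) : LinearIndependent ℝ ![q₁, q₂] := by
  have hq2 := form_ne_zero_of_isRelPrime hd hq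
  have hs : ∀ s t : ℝ, s • q₁ + t • q₂ = 0 → s = 0 := by
    intro s t h
    by_contra hs
    refine not_isUnit_form hd q₂ (hq ⟨MvPolynomial.C (-t / s), ?_⟩ dvd_rfl)
    have h1 : q₁ = (-t / s) • q₂ := by
      rw [div_eq_inv_mul, mul_smul, eq_inv_smul_iff₀ hs, neg_smul]
      exact eq_neg_of_add_eq_zero_left h
    rw [mul_comm, ← MvPolynomial.smul_eq_C_mul]
    exact congrArg Subtype.val h1
  rw [LinearIndependent.pair_iff]
  intro s t h
  have h0 := hs s t h
  refine ⟨h0, ?_⟩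
  rw [h0, zero_smul, zero_add] at h
  exact (smul_eq_zero.1 h).resolve_right fun h => hq2 (by simp [h])

theorem exists_relation_ne_zero {v : Fin 9 → Fin 3 → ℝ} {q₁ q₂ : Form 3 3}
    (hq : LinearIndependent ℝ ![q₁, q₂])
    (h1 : ∀ j, evalAt (v j) q₁ = 0) (h2 : ∀ j, evalAt (v j) q₂ = 0) :
    ∃ u : Fin 9 → ℝ, u ≠ 0 ∧ IsRelation v 3 u := by
  by_contra! hc
  let E : Form 3 3 →ₗ[ℝ] (Fin 9 → ℝ) := LinearMap.pi fun j => evalAt (v j)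
  have hsurj : LinearMap.range E = ⊤ := by
    rw [LinearMap.range_eq_top]
    intro x
    obtain ⟨f, hf⟩ := exists_form_of_forall_relation (v := v) (d := 3) x fun w hw => by
      by_cases h0 : w = 0
      · simp [h0]
      · exact absurd hw (hc w h0)
    exact ⟨f, funext hf⟩
  have hrank := LinearMap.finrank_range_add_finrank_ker E
  rw [hsurj, finrank_top, finrank_form] at hrank
  have hle : Submodule.span ℝ (Set.range ![q₁, q₂]) ≤ LinearMap.ker E := by
    rw [Submodule.span_le]
    rintro _ ⟨i, rfl⟩
    fin_cases i
    · exact LinearMap.mem_ker.2 (funext h1)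
    · exact LinearMap.mem_ker.2 (funext h2)
  have := Submodule.finrank_mono hle
  rw [finrank_span_eq_card hq] at this
  simp [Nat.choose] at hrank this
  omega

/-- Multiplying by the cube of a line through point `i` that misses point `j` gives a cubic relation
with a zero entry, hence the zero relation. -/
theorem relation_sextic_eq_zero {v : Fin 9 → Fin 3 → ℝ} (h : NoFourCollinear v)
    (h7 : NoSevenConconic v) {b : Fin 9 → ℝ} (hb : IsRelation v (2 * 3) b) : b = 0 := by
  ext j
  have key : ∀ i k, evalAt (v j) (lineForm (v i) (v k)) ≠ 0 → b j = 0 := by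
    intro i k hL
    have := relation_cubic_eq_zero h h7 (i := i) (hb.mul (e := 3) (by norm_num)
      (mulForm (c := 3) (by norm_num) (mulForm (c := 2) (by norm_num) (lineForm (v i) (v k))
        (lineForm (v i) (v k))) (lineForm (v i) (v k))))
      (by simp [evalAt_mulForm, evalAt_lineForm_left])
    simpa [evalAt_mulForm, hL] using congrFun this j
  have hex : ∀ j : Fin 9, ∃ i k m : Fin 9, [j, i, k, m].Nodup := by decide
  obtain ⟨i, k, m, hn⟩ := hex j
  rcases h.line_ne_zero_or hn with hL | hL
  · exact key _ _ hL
  · exact key _ _ hL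

theorem pointFunctional_apply (v : Fin 9 → Fin 3 → ℝ) (a : Fin 9 → ℝ) (f : Form 3 (2 * 3)) :
    pointFunctional v a f = ∑ j, a j * evalAt (v j) f := by
  simp [pointFunctional]

/-- The product of two ternary cubics. -/
noncomputable abbrev mulCubic : Form 3 3 →ₗ[ℝ] Form 3 3 →ₗ[ℝ] Form 3 (2 * 3) :=
  mulForm (by norm_num)

/-- A functional on sextics vanishing on the degree six part of the ideal of two coprime cubics
through nine general points is a combination of the point evaluations. -/
theorem exists_eq_pointFunctional {v : Fin 9 → Fin 3 → ℝ} (h : NoFourCollinear v)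
    (h7 : NoSevenConconic v) {q₁ q₂ : Form 3 3}
    (hq : IsRelPrime (q₁ : MvPolynomial (Fin 3) ℝ) q₂)
    (hv1 : ∀ j, evalAt (v j) q₁ = 0) (hv2 : ∀ j, evalAt (v j) q₂ = 0)
    (l : Module.Dual ℝ (Form 3 (2 * 3))) (hl1 : ∀ g, l (mulCubic q₁ g) = 0)
    (hl2 : ∀ g, l (mulCubic q₂ g) = 0) : ∃ b : Fin 9 → ℝ, l = pointFunctional v b := by
  let φ : Form 3 3 × Form 3 3 →ₗ[ℝ] Form 3 (2 * 3) :=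
    (mulCubic q₁).coprod (mulCubic q₂)
  have hφ : ∀ x, φ x = mulCubic q₁ x.1 + mulCubic q₂ x.2 := fun x => by simp [φ]
  have hker : Module.finrank ℝ (LinearMap.ker φ) ≤ 1 := by
    have h0 : (q₂, -q₁) ∈ LinearMap.ker φ := by
      rw [LinearMap.mem_ker, hφ]
      apply Subtype.ext
      simp [coe_mulForm]
      ring
    refine finrank_le_one ⟨_, h0⟩ ?_
    rintro ⟨⟨f, g⟩, hfg⟩
    rw [LinearMap.mem_ker, hφ] at hfg
    have := congrArg Subtype.val hfg
    obtain ⟨c, rfl, rfl⟩ := syzygy_of_isRelPrime (by norm_num) hq (f := f) (g := g) this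
    exact ⟨c, Subtype.ext (Prod.ext rfl ((smul_neg c q₁).trans (neg_smul c q₁).symm))⟩
  have hrank := LinearMap.finrank_range_add_finrank_ker φ
  have hann := Subspace.finrank_add_finrank_dualAnnihilator_eq (LinearMap.range φ)
  have hmem : ∀ k : Module.Dual ℝ (Form 3 (2 * 3)), (∀ g, k (mulCubic q₁ g) = 0) →
      (∀ g, k (mulCubic q₂ g) = 0) → k ∈ (LinearMap.range φ).dualAnnihilator := by
    intro k hk1 hk2
    rw [Submodule.mem_dualAnnihilator]
    rintro _ ⟨x, rfl⟩
    rw [hφ, map_add, hk1, hk2, add_zero]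
  let ψ : (Fin 9 → ℝ) →ₗ[ℝ] Module.Dual ℝ (Form 3 (2 * 3)) :=
    Fintype.linearCombination ℝ fun j => evalAt (v j)
  have hψ : ∀ b, ψ b = pointFunctional v b := fun b => by
    simp [ψ, pointFunctional, Fintype.linearCombination_apply]
  have hinj : Function.Injective ψ := by
    rw [← LinearMap.ker_eq_bot, LinearMap.ker_eq_bot']
    intro b hb
    refine relation_sextic_eq_zero h h7 fun f => ?_
    rw [← pointFunctional_apply, ← hψ, hb, LinearMap.zero_apply]
  have hle : LinearMap.range ψ ≤ (LinearMap.range φ).dualAnnihilator := by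
    rintro _ ⟨b, rfl⟩
    refine hmem _ (fun g => ?_) fun g => ?_ <;>
      rw [hψ, pointFunctional_apply] <;> simp [evalAt_mulForm, hv1, hv2]
  -- The annihilator has dimension at most 28 - (10 + 10 - 1) = 9, the number of independent
  -- evaluations.
  have hfin : Module.finrank ℝ (LinearMap.range φ).dualAnnihilator ≤
      Module.finrank ℝ (LinearMap.range ψ) := by
    rw [LinearMap.finrank_range_of_inj hinj]
    rw [Module.finrank_prod] at hrank
    simp [finrank_form, Nat.choose] at hrank hann ⊢
    omega
  have hl := hmem l hl1 hl2
  rw [← Submodule.eq_of_le_of_finrank_le hle hfin] at hl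
  obtain ⟨b, hb⟩ := hl
  exact ⟨b, by rw [← hψ, hb]⟩

/-! ### The dual cone -/

theorem mem_sosDual {n d : ℕ} {l : Module.Dual ℝ (Form n (2 * d))} :
    l ∈ sosDual n d ↔ ∀ f : Form n d, 0 ≤ l (mulForm (by omega) f f) := by
  rw [sosDual, PointedCone.mem_dual]
  constructor
  · intro h f
    exact h ⟨1, fun _ => f, by simp [coe_mulForm, sq]⟩
  · rintro h g ⟨m, q, hg⟩
    have : g = ∑ i, mulForm (by omega) (q i) (q i) := by
      apply Subtype.ext
      rw [hg]
      simp [coe_mulForm, sq]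
    rw [this, Module.Dual.eval_apply, map_sum]
    exact Finset.sum_nonneg fun i _ => h _

/-- The kernel of a positive semidefinite functional on squares. -/
theorem apply_mul_eq_zero_of_mem_sosDual {n d : ℕ} {l : Module.Dual ℝ (Form n (2 * d))}
    (hl : l ∈ sosDual n d) {q : Form n d} (hq : l (mulForm (by omega) q q) = 0) (g : Form n d) :
    l (mulForm (by omega) q g) = 0 := by
  rw [mem_sosDual] at hl
  have hcomm : mulForm (c := 2 * d) (by omega) g q = mulForm (by omega) q g :=
    Subtype.ext (mul_comm _ _)
  have key : ∀ t : ℝ, 0 ≤ 2 * t * l (mulForm (by omega) q g) + l (mulForm (by omega) g g) := by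
    intro t
    have := hl (t • q + g)
    simp only [map_add, map_smul, LinearMap.add_apply, LinearMap.smul_apply, hq, hcomm,
      smul_eq_mul] at this
    linarith
  by_contra hne
  set B := l (mulForm (by omega) q g) with hB
  -- At this `t` the affine function in `key` equals -1.
  have := key (-(l (mulForm (by omega) g g) + 1) / (2 * B))
  have e : 2 * (-(l (mulForm (c := 2 * d) (by omega) g g) + 1) / (2 * B)) * B =
      -(l (mulForm (by omega) g g) + 1) := by
    field_simp
  rw [e] at this
  linarith

/-! ### Choice of weights and positivity -/

theorem sum_fin_nine_split {k : ℕ} (hk8 : k ≤ 8) (F : Fin 9 → ℝ) :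
    ∑ j, F j = ∑ j ∈ Finset.univ.filter (fun j : Fin 9 => j.val < k), F j +
      ∑ j ∈ Finset.univ.filter (fun j : Fin 9 => k ≤ j.val ∧ j.val < 8), F j + F 8 := by
  have h8 : F 8 = ∑ j ∈ Finset.univ.filter (fun j : Fin 9 => j.val = 8), F j := by
    rw [Finset.sum_eq_single_of_mem 8 (by simp)]
    intro j hj hj8
    exact absurd (Fin.ext (Finset.mem_filter.1 hj).2) hj8
  rw [h8, Finset.sum_filter, Finset.sum_filter, Finset.sum_filter, ← Finset.sum_add_distrib,
    ← Finset.sum_add_distrib]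
  refine Finset.sum_congr rfl fun j _ => ?_
  split_ifs <;> first | omega | simp

/-- The choice of weights: positive except for the last one, with `∑ uⱼ² / aⱼ = 0`, and making
the weighted sum of the values negative. -/
theorem exists_weights {k : ℕ} (hk1 : 1 ≤ k) (hk8 : k ≤ 8) (u y : Fin 9 → ℝ)
    (hu : ∀ j, u j ≠ 0) (hy : ∀ j : Fin 9, j.val < k → y j = 0)
    (h : (∑ j ∈ Finset.univ.filter (fun j : Fin 9 => k ≤ j.val ∧ j.val < 8), u j ^ 2) *
      (∑ j ∈ Finset.univ.filter (fun j : Fin 9 => k ≤ j.val ∧ j.val < 8), y j) < u 8 ^ 2 * y 8) :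
    ∃ a : Fin 9 → ℝ, a 8 = -1 ∧ (∀ j ≠ 8, 0 < a j) ∧ ∑ j, u j ^ 2 / a j = 0 ∧
      ∑ j, a j * y j < 0 := by
  set A := Finset.univ.filter (fun j : Fin 9 => k ≤ j.val ∧ j.val < 8) with hA
  set B := Finset.univ.filter (fun j : Fin 9 => j.val < k) with hB
  set S := ∑ j ∈ A, u j ^ 2
  set P := ∑ j ∈ A, y j
  set T := ∑ j ∈ B, u j ^ 2 with hT
  have hS : 0 ≤ S := Finset.sum_nonneg fun j _ => sq_nonneg _
  have hTpos : 0 < T := by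
    refine Finset.sum_pos (fun j _ => by have := hu j; positivity) ⟨0, ?_⟩
    simp [hB]
    omega
  have hU : 0 < u 8 ^ 2 := by have := hu 8; positivity
  set U := u 8 ^ 2
  obtain ⟨c, hc0, hcS, hcP⟩ : ∃ c : ℝ, 0 < c ∧ S < U * c ∧ c * P < y 8 := by
    set δ := y 8 - S * P / U with hδ
    have hδ0 : 0 < δ := by
      rw [hδ, sub_pos, div_lt_iff₀ hU]; linarith
    have hε : 0 < δ / (|P| + 1) := by positivity
    -- Slightly above `S / U`: the increment changes `c * P` by less than the slack `δ`, whatever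
    -- the sign of `P`.
    refine ⟨S / U + δ / (|P| + 1), by positivity, ?_, ?_⟩
    · rw [mul_add, mul_div_cancel₀ _ hU.ne']
      have := mul_pos hU hε
      linarith
    · have h1 : δ / (|P| + 1) * P < δ := by
        rw [div_mul_eq_mul_div, div_lt_iff₀ (by positivity)]
        have := le_abs_self P
        nlinarith
      have h2 : (S / U + δ / (|P| + 1)) * P = S * P / U + δ / (|P| + 1) * P := by ring
      rw [h2]
      linarith
  have hR : 0 < U - S / c := by
    rw [sub_pos, div_lt_iff₀ hc0]; exact hcS
  -- The solution of `T / M + S / c = U`, positive because `k ≥ 1` gives `T > 0`.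
  set M := T / (U - S / c) with hM
  have hM0 : 0 < M := div_pos hTpos hR
  let a : Fin 9 → ℝ := fun j => if j.val < k then M else if j.val < 8 then c else -1
  have aB : ∀ j ∈ B, a j = M := fun j hj => if_pos (Finset.mem_filter.1 hj).2
  have aA : ∀ j ∈ A, a j = c := fun j hj => by
    have := (Finset.mem_filter.1 hj).2
    simp [a, this.2, this.1]
  have a8 : a 8 = -1 := by simp [a, hk8]
  refine ⟨a, a8, ?_, ?_, ?_⟩
  · intro j hj
    have : j.val < 8 := by
      have := j.2
      have : j.val ≠ 8 := fun h => hj (Fin.ext h)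
      omega
    simp only [a, this, if_true]
    split_ifs
    · exact hM0
    · exact hc0
  · rw [sum_fin_nine_split hk8, a8,
      Finset.sum_congr rfl fun j hj => by rw [aB j hj],
      Finset.sum_congr (s₁ := A) rfl fun j hj => by rw [aA j hj],
      ← Finset.sum_div, ← Finset.sum_div]
    change T / M + S / c + U / -1 = 0
    rw [hM]
    field_simp
    ring
  · rw [sum_fin_nine_split hk8, a8,
      Finset.sum_eq_zero fun j hj => by rw [hy j (Finset.mem_filter.1 hj).2, mul_zero],
      Finset.sum_congr (s₁ := A) rfl fun j hj => by rw [aA j hj], ← Finset.mul_sum]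
    change 0 + c * P + -1 * y 8 < 0
    linarith

/-- Cauchy–Schwarz on the eight positive weights bounds `(u 8 * x 8)²` by `u 8 ^ 2` times the
positive part of the sum. -/
theorem weighted_sum_nonneg {a u x : Fin 9 → ℝ} (ha8 : a 8 = -1) (ha : ∀ j ≠ 8, 0 < a j)
    (hu8 : u 8 ≠ 0) (hau : ∑ j, u j ^ 2 / a j = 0) (hx : ∑ j, u j * x j = 0) :
    0 ≤ ∑ j, a j * x j ^ 2 := by
  rw [← Finset.add_sum_erase _ _ (Finset.mem_univ 8), ha8] at hau ⊢
  rw [← Finset.add_sum_erase _ _ (Finset.mem_univ 8)] at hx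
  have hCS := Finset.sum_sq_le_sum_mul_sum_of_sq_le_mul (Finset.univ.erase (8 : Fin 9))
    (r := fun j => u j * x j) (f := fun j => u j ^ 2 / a j) (g := fun j => a j * x j ^ 2)
    (fun j hj => by have := ha j (Finset.ne_of_mem_erase hj); positivity)
    (fun j hj => by have := ha j (Finset.ne_of_mem_erase hj); positivity)
    (fun j hj => by
      have := (ha j (Finset.ne_of_mem_erase hj)).ne'
      apply le_of_eq
      field_simp)
  have h1 : ∑ j ∈ Finset.univ.erase (8 : Fin 9), u j * x j = -(u 8 * x 8) := by linarith
  have h2 : ∑ j ∈ Finset.univ.erase (8 : Fin 9), u j ^ 2 / a j = u 8 ^ 2 := by linarith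
  rw [h1, h2] at hCS
  have hU : 0 < u 8 ^ 2 := by positivity
  have : x 8 ^ 2 ≤ ∑ j ∈ Finset.univ.erase (8 : Fin 9), a j * x j ^ 2 :=
    le_of_mul_le_mul_left (by linarith) hU
  linarith

/-! ### Extremality -/

theorem spansExtremeRay_pointFunctional {v : Fin 9 → Fin 3 → ℝ} (h : NoFourCollinear v)
    (h7 : NoSevenConconic v) {q₁ q₂ : Form 3 3}
    (hq : IsRelPrime (q₁ : MvPolynomial (Fin 3) ℝ) q₂)
    (hv1 : ∀ j, evalAt (v j) q₁ = 0) (hv2 : ∀ j, evalAt (v j) q₂ = 0) {u a : Fin 9 → ℝ}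
    (hu : ∀ j, u j ≠ 0)
    (huniq : ∀ w, IsRelation v 3 w → ∃ c : ℝ, w = c • u)
    (ha : ∀ j, a j ≠ 0) (ha0 : 0 < a 0) (ha1 : 0 < a 1) (hau : ∑ j, u j ^ 2 / a j = 0)
    (hmem : pointFunctional v a ∈ sosDual 3 3) :
    SpansExtremeRay (sosDual 3 3) (pointFunctional v a) := by
  have hform : ∀ x : Fin 9 → ℝ, ∑ j, u j * x j = 0 →
      ∃ f : Form 3 3, ∀ j, evalAt (v j) f = x j := by
    intro x hx
    refine exists_form_of_forall_relation x fun w hw => ?_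
    obtain ⟨c, rfl⟩ := huniq w hw
    simp only [Pi.smul_apply, smul_eq_mul, mul_assoc, ← Finset.mul_sum, hx, mul_zero]
  -- These values are orthogonal to `u` exactly because `∑ u_j² / a_j = 0`.
  obtain ⟨q₃, hq3⟩ := hform (fun j => u j / a j) (by
    rw [← hau]; exact Finset.sum_congr rfl fun j _ => by ring)
  have hzero : ∀ q ∈ ({q₁, q₂, q₃} : Set (Form 3 3)),
      pointFunctional v a (mulCubic q q) = 0 := by
    intro q hmq
    rw [pointFunctional_apply]
    rcases hmq with rfl | rfl | rfl
    · simp [evalAt_mulForm, hv1]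
    · simp [evalAt_mulForm, hv2]
    · rw [← hau]
      refine Finset.sum_congr rfl fun j _ => ?_
      rw [evalAt_mulForm, hq3]
      have := ha j
      field_simp
  -- A cubic nonzero only at two points of positive weight: its square shows `l_a ≠ 0` and later
  -- fixes the sign of `c`.
  obtain ⟨f, hf⟩ := hform (fun j => if j = 0 then u 1 else if j = 1 then -u 0 else 0) (by
    rw [Fintype.sum_eq_add 0 1 (by decide) fun j hj => by simp [hj.1, hj.2]]
    simp
    ring)
  have hpos : 0 < pointFunctional v a (mulCubic f f) := by
    have e : pointFunctional v a (mulCubic f f) = a 0 * u 1 ^ 2 + a 1 * u 0 ^ 2 := by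
      rw [pointFunctional_apply]
      simp only [evalAt_mulForm, hf]
      rw [Fintype.sum_eq_add 0 1 (by decide) fun j hj => by simp [hj.1, hj.2]]
      simp
      ring
    rw [e]
    have := hu 0
    have := hu 1
    positivity
  refine ⟨fun h0 => by simp [h0] at hpos, ?_, ?_⟩
  · rw [PointedCone.hull, Submodule.span_le, Set.singleton_subset_iff]
    exact hmem
  intro x y t hx hy ht hxy
  obtain ⟨r, hr⟩ := Submodule.mem_span_singleton.1 hxy
  have hxq : ∀ q ∈ ({q₁, q₂, q₃} : Set (Form 3 3)), ∀ g, x (mulCubic q g) = 0 := by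
    intro q hmq
    refine apply_mul_eq_zero_of_mem_sosDual hx ?_
    have e := congrArg (fun l : Module.Dual ℝ (Form 3 (2 * 3)) => l (mulCubic q q)) hr
    have e' : t * x (mulCubic q q) + y (mulCubic q q) =
        (r : ℝ) * pointFunctional v a (mulCubic q q) := e.symm
    rw [hzero q hmq, mul_zero] at e'
    have hx' := mem_sosDual.1 hx q
    have hy' := mem_sosDual.1 hy q
    change 0 ≤ y (mulCubic q q) at hy'
    have : t * x (mulCubic q q) ≤ 0 := by linarith
    exact le_antisymm (nonpos_of_mul_nonpos_right this ht) hx'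
  obtain ⟨b, rfl⟩ := exists_eq_pointFunctional h h7 hq hv1 hv2 x (hxq _ (by simp))
    (hxq _ (by simp))
  obtain ⟨c, hc⟩ := huniq (fun j => b j * evalAt (v j) q₃) fun g => by
    have := hxq q₃ (by simp) g
    rw [pointFunctional_apply] at this
    simpa [evalAt_mulForm, mul_assoc] using this
  have hb : b = c • a := by
    ext j
    have hj := congrFun hc j
    simp only [hq3, Pi.smul_apply, smul_eq_mul] at hj ⊢
    have := ha j
    have := hu j
    field_simp at hj
    linarith
  have hbc : pointFunctional v b = c • pointFunctional v a := by
    simp [hb, pointFunctional, Finset.smul_sum, mul_smul]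
  have hc0 : 0 ≤ c := by
    have := mem_sosDual.1 hx f
    rw [hbc, LinearMap.smul_apply, smul_eq_mul] at this
    exact nonneg_of_mul_nonneg_left this hpos
  exact Submodule.mem_span_singleton.2 ⟨⟨c, hc0⟩, hbc.symm⟩

end SexticSOS

open SexticSOS in
theorem theorem3p1
    -- a sextic on the boundary of the cone of nonnegative sextics, not a sum of squares
    (p : Form 3 (2 * 3))
    (hp : p ∈ frontier (nonnegForms 3 (2 * 3)))
    (hsos : p ∉ sosForms 3 3)
    -- affine representatives of nine distinct real projective points in general position
    (v : Fin 9 → Fin 3 → ℝ)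
    (hv : ∀ j, v j ≠ 0)
    (hdist : Function.Injective fun j => Projectivization.mk ℝ (v j) (hv j))
    (hgen : Generic v)
    -- the nine points are the intersection of two coprime cubics
    (q₁ q₂ : Form 3 3)
    (hq : IsRelPrime (q₁ : MvPolynomial (Fin 3) ℝ) (q₂ : MvPolynomial (Fin 3) ℝ))
    (hA : projVariety q₁ ∩ projVariety q₂ =
      Set.range fun j => Projectivization.mk ℝ (v j) (hv j))
    -- the zeros of `p` are the first `k` points
    (k : ℕ) (hk1 : 1 ≤ k) (hk8 : k ≤ 8)
    (hpA : projVariety p =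
      (fun j => Projectivization.mk ℝ (v j) (hv j)) '' {j : Fin 9 | j.val < k}) :
    -- the Cayley-Bacharach relation exists, has nonzero coefficients, and is unique up to scaling
    (∃ u : Fin 9 → ℝ, IsCayleyBacharach v u ∧ (∀ j, u j ≠ 0) ∧
      ∀ w : Fin 9 → ℝ, IsCayleyBacharach v w → ∃ c : ℝ, w = c • u) ∧
    -- the certificate
    ∀ u : Fin 9 → ℝ, IsCayleyBacharach v u →
      (∑ j ∈ Finset.univ.filter (fun j : Fin 9 => k ≤ j.val ∧ j.val < 8), u j ^ 2) *
          (∑ j ∈ Finset.univ.filter (fun j : Fin 9 => k ≤ j.val ∧ j.val < 8), evalAt (v j) p) <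
        u 8 ^ 2 * evalAt (v 8) p →
      ∃ a : Fin 9 → ℝ,
        pointFunctional v a p < 0 ∧
        (∀ g ∈ sosForms 3 3, 0 ≤ pointFunctional v a g) ∧
        SpansExtremeRay (sosDual 3 3) (pointFunctional v a) := by

  have h4 := hgen.noFourCollinear hv hdist
  have h7 := hgen.noSevenConconic
  have hq12 : ∀ j, evalAt (v j) q₁ = 0 ∧ evalAt (v j) q₂ = 0 := by
    intro j
    have : Projectivization.mk ℝ (v j) (hv j) ∈ projVariety q₁ ∩ projVariety q₂ := by
      rw [hA]; exact ⟨j, rfl⟩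
    exact ⟨(mk_mem_projVariety _ _ _).1 this.1, (mk_mem_projVariety _ _ _).1 this.2⟩
  have hv1 := fun j => (hq12 j).1
  have hv2 := fun j => (hq12 j).2
  have hne : ∀ u : Fin 9 → ℝ, IsCayleyBacharach v u → ∀ j, u j ≠ 0 := fun u hu j hj =>
    hu.1 (relation_cubic_eq_zero h4 h7 hu.2 hj)
  have huniq : ∀ u : Fin 9 → ℝ, IsCayleyBacharach v u → ∀ w, IsRelation v 3 w →
      ∃ c : ℝ, w = c • u := by
    intro u hu w hw
    -- This scalar makes entry 0 of the difference vanish, hence the whole difference.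
    refine ⟨w 0 / u 0, ?_⟩
    rw [← sub_eq_zero]
    refine relation_cubic_eq_zero h4 h7 (i := 0) (fun f => ?_) ?_
    · simp only [Pi.sub_apply, Pi.smul_apply, smul_eq_mul, sub_mul, mul_assoc,
        Finset.sum_sub_distrib, ← Finset.mul_sum, hu.2 f, hw f]
      ring
    · have := hne u hu 0
      simp [this]
  constructor
  · obtain ⟨u, hu0, hu⟩ := exists_relation_ne_zero
      (linearIndependent_of_isRelPrime (by norm_num) hq) hv1 hv2
    exact ⟨u, ⟨hu0, hu⟩, hne u ⟨hu0, hu⟩, fun w hw => huniq u ⟨hu0, hu⟩ w hw.2⟩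
  intro u hu hlt
  have hy : ∀ j : Fin 9, j.val < k → evalAt (v j) p = 0 := by
    intro j hj
    rw [← mk_mem_projVariety p (v j) (hv j), hpA]
    exact ⟨j, hj, rfl⟩
  obtain ⟨a, ha8, hapos, hau, hneg⟩ :=
    exists_weights hk1 hk8 u (fun j => evalAt (v j) p) (hne u hu) hy hlt
  have hmem : pointFunctional v a ∈ sosDual 3 3 := by
    rw [mem_sosDual]
    intro f
    rw [pointFunctional_apply]
    simp only [evalAt_mulForm, ← sq]
    exact weighted_sum_nonneg ha8 hapos (hne u hu 8) hau (hu.2 f)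
  refine ⟨a, by rwa [pointFunctional_apply], fun g hg => hmem hg, ?_⟩
  refine spansExtremeRay_pointFunctional h4 h7 hq hv1 hv2 (hne u hu) (huniq u hu) ?_
    (hapos 0 (by decide)) (hapos 1 (by decide)) hau hmem
  intro j
  by_cases hj : j = 8
  · rw [hj, ha8]; norm_num
  · exact (hapos j hj).ne'
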